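/- For irrational $\theta\in(0,1)$ let $f(x)=1$ if the fractional part of $x$ lies in $[0,1/2)$ and $f(x)=-1$ if it lies in $[1/2,1)$; put $S_i(x)=\sum_{j=0}^{i-1}f(x+j\theta)$, and for $n\ge 2$ let $M_n(x)=\max\{S_i(x):1\le i\le n-1\}$ and $m_n(x)=\min\{S_i(x):1\le i\le n-1\}$, with $M_1(x)=m_1(x)=S_1(x)$. Suppose that $\{c_n\}$ and $\{d_n\}$ are two increasing (that is, non-decreasing) sequences of positive real numbers, both in $o(n)$, that the differences $c_{n+1}-c_n$ and $d_{n+1}-d_n$ are in $O(1)$, and that at least one of $\{c_n\}$, $\{d_n\}$ is divergent (tends to $\infty$). Then there is a dense set of irrational $\theta\in(0,1)$ such that all of the following hold. If $\{c_n\}$ is divergent, then \[\limsup_{n\to\infty}\frac{M_n(0)}{c_n}=1,\] while if $\{c_n\}$ is bounded, then the sequence $M_n(0)$ is bounded. If $\{d_n\}$ is divergent, then \[\limsup_{n\to\infty}\frac{|m_n(0)|}{d_n}=1,\] while if $\{d_n\}$ is bounded, then the sequence $m_n(0)$ is bounded. -/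

import Mathlib

open Filter Topology Asymptotics

/-- The function `χ_[0,1/2) - χ_[1/2,1)` on the circle `ℝ/ℤ = [0,1)`, as a 1-periodic function
on `ℝ` with values in `ℤ`. -/
noncomputable def halfSign (x : ℝ) : ℤ :=
  if Int.fract x < 1 / 2 then 1 else -1

/-- The `1/2`-discrepancy sums `S_n(x) = ∑_{i=0}^{n-1} f(x + iθ)`. -/
noncomputable def discSum (θ x : ℝ) (n : ℕ) : ℤ :=
  ∑ i ∈ Finset.range n, halfSign (x + i * θ)

/-- The nonempty set of times `{1, …, n-1}` for `n ≥ 2`; for `n ≤ 1` it is `{1}`. -/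
def discTimes (n : ℕ) : Finset ℕ := Finset.Icc 1 (max 1 (n - 1))

theorem discTimes_nonempty (n : ℕ) : (discTimes n).Nonempty :=
  ⟨1, by simp [discTimes]⟩

/-- The maximal discrepancy `M_n(x) = max {S_i(x) : i = 1, …, n-1}`, with `M_1(x) = S_1(x)`. -/
noncomputable def maxDisc (θ x : ℝ) (n : ℕ) : ℤ :=
  (discTimes n).sup' (discTimes_nonempty n) (discSum θ x)

/-- The minimal discrepancy `m_n(x) = min {S_i(x) : i = 1, …, n-1}`, with `m_1(x) = S_1(x)`. -/
noncomputable def minDisc (θ x : ℝ) (n : ℕ) : ℤ :=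
  (discTimes n).inf' (discTimes_nonempty n) (discSum θ x)

/-! The angle is a limit of fractions `p / q` with `q` odd, each of which fixes the sums at times up
to `q` for all angles near it. Along `p / q` the signs at `j` and `-j` cancel except at multiples of
`q`, where the sign is `+1`, so the sum climbs by `1` in every period (`ratSum_period`). Along a
fraction `p' / (2 * h)` approached from the left, a half-turn reverses every sign, so the sums are
periodic and hence bounded.

Let `p' / (2 * h)` be the right Farey neighbour of `p / q`, that is, `p' * q - 2 * h * p = 1`. Its
left sums follow those of `p / q` up to time `h`, climbing to about `h / q`, and then retrace the
climb backwards; they never go below the old minimum (`leftSum_bounds`). The fraction `(k * p' + p)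
/ (2 * h * k + q)` has odd denominator and repeats this pattern about `k` times (`exists_refine`).
Taking `h` near the first time at which `n / q` overtakes `c n` makes the climb touch `c` without
crossing it (`exists_rise`); since `c` is `o(n)`, such a time exists. A large `k` then lets the
divergent bounds outgrow everything produced so far.

Changing `p` to `-p` turns climbs into descents. Alternating the two, or repeating only one when the
other bound does not diverge, gives nested neighbourhoods whose common point is the angle
(`exists_angle`). -/

/-! ### Sums along a fraction with odd denominator. -/

/-- The sign `(-1)^z`, as an integer. -/
def paritySign (z : ℤ) : ℤ := if Even z then 1 else -1

theorem paritySign_add_even {z w : ℤ} (hw : Even w) : paritySign (z + w) = paritySign z := by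
  simp [paritySign, Int.even_add, hw]

theorem paritySign_add_odd {z w : ℤ} (hw : Odd w) : paritySign (z + w) = -paritySign z := by
  have h : ¬ Even w := Int.not_even_iff_odd.mpr hw
  by_cases hz : Even z <;> simp [paritySign, Int.even_add, h, hz]

theorem paritySign_neg (z : ℤ) : paritySign (-z) = paritySign z := by
  simp [paritySign]

theorem halfSign_eq_paritySign (x : ℝ) : halfSign x = paritySign ⌊2 * x⌋ := by
  have hx : 2 * x = 2 * Int.fract x + ((2 * ⌊x⌋ : ℤ) : ℝ) := by
    have := Int.fract_add_floor x
    push_cast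
    linarith
  have h0 := Int.fract_nonneg x
  have h1 := Int.fract_lt_one x
  rw [hx, Int.floor_add_intCast, paritySign_add_even (even_two_mul _), halfSign]
  split_ifs with h
  · have : ⌊2 * Int.fract x⌋ = 0 := by
      rw [Int.floor_eq_iff]; constructor <;> push_cast <;> linarith
    simp [this, paritySign]
  · have : ⌊2 * Int.fract x⌋ = 1 := by
      rw [Int.floor_eq_iff]; constructor <;> push_cast <;> linarith
    simp [this, paritySign]

/-- The value of `halfSign` at `j * p / q`, in integer arithmetic. -/
def ratSign (p q j : ℤ) : ℤ := paritySign (2 * j * p / q)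

/-- The sum of `halfSign (j * p / q)` over `1 ≤ j ≤ n`, in integer arithmetic. -/
def ratSum (p : ℤ) (q n : ℕ) : ℤ := ∑ j ∈ Finset.range n, ratSign p q (j + 1)

theorem not_dvd_two_mul_mul {p q j : ℤ} (hq : Odd q) (hpq : IsCoprime p q) (hj : ¬ q ∣ j) :
    ¬ q ∣ 2 * j * p := by
  intro h
  have h2 : IsCoprime q 2 := by
    obtain ⟨m, rfl⟩ := hq
    exact ⟨1, -m, by ring⟩
  exact hj (h2.dvd_of_dvd_mul_left (hpq.symm.dvd_of_dvd_mul_right h))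

theorem neg_ediv_of_not_dvd {x q : ℤ} (hq : 0 < q) (hx : ¬ q ∣ x) : -x / q = -(x / q) - 1 := by
  have h1 := Int.emod_add_mul_ediv x q
  have h2 := Int.emod_nonneg x hq.ne'
  have h3 := Int.emod_lt_of_pos x hq
  have h4 : x % q ≠ 0 := fun h => hx (Int.dvd_of_emod_eq_zero h)
  have h5 : 0 < x % q := lt_of_le_of_ne h2 (Ne.symm h4)
  rw [Int.ediv_eq_iff_of_pos hq]
  constructor <;> nlinarith

theorem ratSign_add_period (p : ℤ) {q : ℤ} (hq : q ≠ 0) (j : ℤ) :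
    ratSign p q (j + q) = ratSign p q j := by
  have : 2 * (j + q) * p = 2 * j * p + q * (2 * p) := by ring
  rw [ratSign, this, Int.add_mul_ediv_left _ _ hq, paritySign_add_even (even_two_mul p), ratSign]

theorem ratSign_neg {p q j : ℤ} (hq0 : 0 < q) (hq : Odd q) (hpq : IsCoprime p q) (hj : ¬ q ∣ j) :
    ratSign p q (-j) = -ratSign p q j := by
  have h : 2 * -j * p = -(2 * j * p) := by ring
  rw [ratSign, h, neg_ediv_of_not_dvd hq0 (not_dvd_two_mul_mul hq hpq hj), sub_eq_add_neg,
    paritySign_add_odd (by decide), paritySign_neg, ratSign]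

theorem not_natCast_dvd_succ {q j : ℕ} (hj : j + 1 < q) : ¬ (q : ℤ) ∣ (j : ℤ) + 1 := by
  intro h
  have := Int.le_of_dvd (by positivity) h
  omega

theorem ratSum_neg {p : ℤ} {q n : ℕ} (hq : Odd (q : ℤ)) (hpq : IsCoprime p (q : ℤ)) (hn : n < q) :
    ratSum (-p) q n = -ratSum p q n := by
  rw [ratSum, ratSum, ← Finset.sum_neg_distrib]
  refine Finset.sum_congr rfl fun j hj => ?_
  have hj' := Finset.mem_range.mp hj
  rw [← ratSign_neg (by omega) hq hpq (not_natCast_dvd_succ (by omega))]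
  simp only [ratSign]
  congr 2
  ring

theorem ratSum_add (p : ℤ) (q m n : ℕ) :
    ratSum p q (m + n) = ratSum p q m + ∑ j ∈ Finset.range n, ratSign p q (m + j + 1) := by
  rw [ratSum, Finset.sum_range_add, ratSum]
  push_cast
  rfl

/-- The terms `j` and `q - j` cancel; only `j = q` remains, at the point `0`, where the sign is
`+1`. This is the upward drift behind the whole construction. -/
theorem ratSum_period {p : ℤ} {q : ℕ} (hq : Odd (q : ℤ)) (hpq : IsCoprime p (q : ℤ)) :
    ratSum p q q = 1 := by
  obtain ⟨m, rfl⟩ : ∃ m, q = m + 1 := Nat.exists_eq_succ_of_ne_zero (by rintro rfl; simp at hq)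
  have h1 : ratSign p ((m + 1 : ℕ) : ℤ) ((m : ℤ) + 1) = 1 := by
    have := ratSign_add_period p (q := ((m + 1 : ℕ) : ℤ)) (by omega) 0
    push_cast at this ⊢
    rw [zero_add] at this
    rw [this]
    simp [ratSign, paritySign]
  have h2 : ∑ j ∈ Finset.range m, ratSign p ((m + 1 : ℕ) : ℤ) ((j : ℤ) + 1)
      = -∑ j ∈ Finset.range m, ratSign p ((m + 1 : ℕ) : ℤ) ((j : ℤ) + 1) := by
    conv_lhs => rw [← Finset.sum_range_reflect]
    rw [← Finset.sum_neg_distrib]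
    refine Finset.sum_congr rfl fun j hj => ?_
    have hj' := Finset.mem_range.mp hj
    rw [← ratSign_neg (by omega) hq hpq (not_natCast_dvd_succ (by omega)),
      ← ratSign_add_period p (by omega) (-((j : ℤ) + 1))]
    congr 1
    omega
  rw [ratSum, Finset.sum_range_succ, h1]
  omega

theorem ratSum_add_period {p : ℤ} {q : ℕ} (hq : Odd (q : ℤ)) (hpq : IsCoprime p (q : ℤ)) (n : ℕ) :
    ratSum p q (n + q) = ratSum p q n + 1 := by
  have hq0 : (q : ℤ) ≠ 0 := by rintro h; simp [h] at hq
  rw [add_comm n q, ratSum_add, ratSum_period hq hpq, add_comm, ratSum]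
  congr 1
  refine Finset.sum_congr rfl fun j _ => ?_
  rw [← ratSign_add_period p hq0 ((j : ℤ) + 1)]
  congr 1
  ring

theorem ratSum_add_mul_period {p : ℤ} {q : ℕ} (hq : Odd (q : ℤ)) (hpq : IsCoprime p (q : ℤ))
    (n m : ℕ) : ratSum p q (n + m * q) = ratSum p q n + m := by
  induction m with
  | zero => simp
  | succ m ih =>
    have : n + (m + 1) * q = n + m * q + q := by ring
    rw [this, ratSum_add_period hq hpq, ih]
    push_cast
    ring

theorem ratSum_mul_period {p : ℤ} {q : ℕ} (hq : Odd (q : ℤ)) (hpq : IsCoprime p (q : ℤ))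
    (m : ℕ) : ratSum p q (m * q) = m := by
  have := ratSum_add_mul_period hq hpq 0 m
  simpa [ratSum] using this

theorem ratSum_eq_div_add_mod {p : ℤ} {q : ℕ} (hq : Odd (q : ℤ)) (hpq : IsCoprime p (q : ℤ))
    (n : ℕ) : ratSum p q n = ratSum p q (n % q) + (n / q : ℕ) := by
  rw [← ratSum_add_mul_period hq hpq, Nat.mod_add_div']

/-! ### Left limits along a fraction with even denominator. -/

/-- The value of `halfSign` just to the left of `j * p' / (2 * h)`. -/
def leftSign (p' h j : ℤ) : ℤ := paritySign ((j * p' - 1) / h)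

/-- The sum of the left limits of `halfSign` at `j * p' / (2 * h)` over `1 ≤ j ≤ n`. -/
def leftSum (p' : ℤ) (h n : ℕ) : ℤ := ∑ j ∈ Finset.range n, leftSign p' h (j + 1)

theorem leftSign_add_half {p' h : ℤ} (hp' : Odd p') (hh : h ≠ 0) (j : ℤ) :
    leftSign p' h (j + h) = -leftSign p' h j := by
  have : (j + h) * p' - 1 = j * p' - 1 + h * p' := by ring
  rw [leftSign, this, Int.add_mul_ediv_left _ _ hh, paritySign_add_odd hp', leftSign]

theorem leftSign_half {p' h : ℤ} (hp' : Odd p') (hh : 0 < h) : leftSign p' h h = 1 := by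
  have : (h * p' - 1) / h = p' - 1 := by
    rw [Int.ediv_eq_iff_of_pos hh]
    constructor <;> nlinarith
  rw [leftSign, this, paritySign, if_pos]
  simpa [Int.even_sub_one] using hp'

theorem leftSign_half_sub {p' h j : ℤ} (hp' : Odd p') (hcop : IsCoprime p' h) (hj : 0 < j)
    (hjh : j < h) : leftSign p' h (h - j) = leftSign p' h j := by
  have hh : 0 < h := hj.trans hjh
  have hnd : ¬ h ∣ j * p' := by
    intro hd
    have := Int.le_of_dvd hj (hcop.symm.dvd_of_dvd_mul_right hd)
    omega
  have h1 := Int.emod_add_mul_ediv (j * p') h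
  have h2 := Int.emod_nonneg (j * p') hh.ne'
  have h3 := Int.emod_lt_of_pos (j * p') hh
  have h4 : j * p' % h ≠ 0 := fun hd => hnd (Int.dvd_of_emod_eq_zero hd)
  have h5 : 0 < j * p' % h := lt_of_le_of_ne h2 (Ne.symm h4)
  have h6 : (j * p' - 1) / h = j * p' / h := by
    rw [Int.ediv_eq_iff_of_pos hh]
    constructor <;> nlinarith
  have h7 : ((h - j) * p' - 1) / h = -(j * p' / h) + (p' - 1) := by
    rw [Int.ediv_eq_iff_of_pos hh]
    constructor <;> nlinarith
  rw [leftSign, h7, paritySign_add_even (by simpa [Int.even_sub_one] using hp'), paritySign_neg,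
    leftSign, h6]

theorem leftSum_add (p' : ℤ) (h m n : ℕ) :
    leftSum p' h (m + n) = leftSum p' h m + ∑ j ∈ Finset.range n, leftSign p' h (m + j + 1) := by
  rw [leftSum, Finset.sum_range_add, leftSum]
  push_cast
  rfl

theorem leftSum_half_add_eq_sub {p' : ℤ} {h : ℕ} (hp' : Odd p') (hh : 0 < h) (i : ℕ) :
    leftSum p' h (h + i) = leftSum p' h h - leftSum p' h i := by
  rw [leftSum_add, sub_eq_add_neg]
  congr 1
  rw [leftSum, ← Finset.sum_neg_distrib]
  refine Finset.sum_congr rfl fun j _ => ?_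
  rw [← leftSign_add_half hp' (by omega)]
  congr 1
  ring

/-- The signs on the first half-period are symmetric under `j ↦ h - j`, and the second half-period
negates them. So the sums run backwards after time `h`, shifted by the unpaired term `j = h`, which
is `1`. -/
theorem leftSum_half_add {p' : ℤ} {h i : ℕ} (hp' : Odd p') (hcop : IsCoprime p' (h : ℤ))
    (hi : i < h) : leftSum p' h (h + i) = leftSum p' h (h - 1 - i) + 1 := by
  have hh : h = h - 1 - i + (i + 1) := by omega
  have key : leftSum p' h h = leftSum p' h (h - 1 - i) + (leftSum p' h i + 1) := by
    conv_lhs => rw [show leftSum p' h h = leftSum p' h (h - 1 - i + (i + 1)) by rw [← hh]]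
    rw [leftSum_add]
    congr 1
    rw [← Finset.sum_range_reflect, Finset.sum_range_succ', leftSum]
    congr 1
    · refine Finset.sum_congr rfl fun j hj => ?_
      have hj' := Finset.mem_range.mp hj
      rw [← leftSign_half_sub hp' hcop (by omega) (by omega)]
      congr 1
      omega
    · convert leftSign_half hp' (h := h) (by omega) using 2
      omega
  rw [leftSum_half_add_eq_sub hp' (by omega), key]
  ring

theorem leftSum_add_period {p' : ℤ} {h : ℕ} (hp' : Odd p') (hh : 0 < h) (n : ℕ) :
    leftSum p' h (n + 2 * h) = leftSum p' h n := by
  have : n + 2 * h = h + (h + n) := by ring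
  rw [this, leftSum_half_add_eq_sub hp' hh, leftSum_half_add_eq_sub hp' hh]
  ring

theorem leftSum_mod {p' : ℤ} {h : ℕ} (hp' : Odd p') (hh : 0 < h) (n : ℕ) :
    leftSum p' h n = leftSum p' h (n % (2 * h)) := by
  have : Function.Periodic (leftSum p' h) (2 * h) := leftSum_add_period hp' hh
  exact (this.map_mod_nat n).symm

/-- The points `2jp/q` and `jp'/h` differ by `j/(hq) ≤ 1/q`, while the next integer above `2jp/q` is
at least `1/q` away. It can be hit exactly, and this is why left limits are used. -/
theorem ratSign_eq_leftSign_of_le {p p' q h j : ℤ} (hq : 0 < q) (hdet : p' * q - 2 * h * p = 1)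
    (hj : 0 < j) (hjh : j ≤ h) : leftSign p' h j = ratSign p q j := by
  have hh : 0 < h := hj.trans_le hjh
  have h1 := Int.emod_add_mul_ediv (2 * j * p) q
  have h2 := Int.emod_nonneg (2 * j * p) hq.ne'
  have h3 := Int.emod_lt_of_pos (2 * j * p) hq
  set r := 2 * j * p % q
  set z := 2 * j * p / q with hz
  have key : q * (j * p' - 1 - h * z) = j + h * r - q := by
    linear_combination j * hdet - h * h1
  have h4 : 0 ≤ h * r := by positivity
  have h5 : h * r ≤ h * (q - 1) := mul_le_mul_of_nonneg_left (by omega) hh.le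
  have lo : -1 < j * p' - 1 - h * z := by
    by_contra! hc
    nlinarith
  have hi : j * p' - 1 - h * z < h := by
    by_contra! hc
    nlinarith
  rw [leftSign, ratSign, ← hz]
  congr 1
  rw [Int.ediv_eq_iff_of_pos hh]
  constructor <;> nlinarith

/-- Here `2jP/q'` lies below `jp'/h` by `j/(hq') < 1/h`, so no multiple of `1/h`, in particular no
integer, separates it from the left side of `jp'/h`. -/
theorem ratSign_eq_leftSign {p' q' h j P : ℤ} (hh : 0 < h) (hdet : p' * q' - 2 * h * P = 1)
    (hj : 0 < j) (hjq : j < q') : ratSign P q' j = leftSign p' h j := by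
  have h1 := Int.emod_add_mul_ediv (j * p' - 1) h
  have h2 := Int.emod_nonneg (j * p' - 1) hh.ne'
  have h3 := Int.emod_lt_of_pos (j * p' - 1) hh
  have hq : 0 < q' := hj.trans hjq
  set r := (j * p' - 1) % h
  set z := (j * p' - 1) / h with hz
  have key : h * (2 * j * P - q' * z) = q' * (r + 1) - j := by
    linear_combination -j * hdet - q' * h1
  have lo : 0 < 2 * j * P - q' * z := by
    by_contra! hc
    nlinarith
  have hi : 2 * j * P - q' * z < q' := by
    by_contra! hc
    nlinarith
  rw [leftSign, ratSign, ← hz]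
  congr 1
  rw [Int.ediv_eq_iff_of_pos hq]
  constructor <;> nlinarith

theorem leftSum_eq_ratSum {p p' : ℤ} {q h n : ℕ} (hq : 0 < q) (hdet : p' * q - 2 * h * p = 1)
    (hn : n ≤ h) : leftSum p' h n = ratSum p q n := by
  refine Finset.sum_congr rfl fun j hj => ?_
  have hj' := Finset.mem_range.mp hj
  exact ratSign_eq_leftSign_of_le (by omega) hdet (by omega) (by omega)

theorem ratSum_eq_leftSum {P p' : ℤ} {q' h n : ℕ} (hh : 0 < h) (hdet : p' * q' - 2 * h * P = 1)
    (hn : n < q') : ratSum P q' n = leftSum p' h n := by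
  refine Finset.sum_congr rfl fun j hj => ?_
  have hj' := Finset.mem_range.mp hj
  exact ratSign_eq_leftSign (by omega) hdet (by omega) (by omega)

/-! ### From a fraction to the angles near it. -/

/-- For `0 < i < q` the number `2ip/q` is at least `1/q` from every integer, and replacing `p/q` by
`θ` moves it by less than `1/q`. The strictness also yields irrationality later. -/
theorem floor_two_mul_of_near {p : ℤ} {q j : ℕ} {θ : ℝ} (hq : Odd (q : ℤ))
    (hpq : IsCoprime p (q : ℤ)) (hθ : |θ - p / q| ≤ 1 / (2 * (q : ℝ) ^ 2)) (hj : j + 1 < q) :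
    ((2 * ((j : ℤ) + 1) * p / (q : ℤ) : ℤ) : ℝ) < 2 * ((j + 1 : ℕ) * θ) ∧
      2 * ((j + 1 : ℕ) * θ) < ((2 * ((j : ℤ) + 1) * p / (q : ℤ) : ℤ) : ℝ) + 1 := by
  have hq0 : (0 : ℤ) < q := by omega
  have h1 := Int.emod_add_mul_ediv (2 * ((j : ℤ) + 1) * p) q
  have h2 := Int.emod_nonneg (2 * ((j : ℤ) + 1) * p) hq0.ne'
  have h3 := Int.emod_lt_of_pos (2 * ((j : ℤ) + 1) * p) hq0
  have h4 : 2 * ((j : ℤ) + 1) * p % q ≠ 0 := fun hd =>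
    not_dvd_two_mul_mul hq hpq (not_natCast_dvd_succ hj) (Int.dvd_of_emod_eq_zero hd)
  set z := 2 * ((j : ℤ) + 1) * p / (q : ℤ)
  set r := 2 * ((j : ℤ) + 1) * p % (q : ℤ)
  have hr1 : (1 : ℝ) ≤ r := by exact_mod_cast (by omega : (1 : ℤ) ≤ r)
  have hr2 : (r : ℝ) + 1 ≤ q := by exact_mod_cast (by omega : r + 1 ≤ (q : ℤ))
  have h1' : (r : ℝ) + q * z = 2 * (j + 1) * p := by exact_mod_cast h1
  have hQ : (0 : ℝ) < q := by exact_mod_cast hq0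
  have hJ : (j : ℝ) + 1 + 1 ≤ q := by exact_mod_cast hj
  set δ := θ - p / q with hδ
  have hθδ : q * θ = p + q * δ := by rw [hδ]; field_simp; ring
  have hsmall : |2 * (j + 1) * (q * δ)| < 1 := by
    have : |q * δ| ≤ 1 / (2 * q) := by
      rw [abs_mul, abs_of_pos hQ]
      calc q * |δ| ≤ q * (1 / (2 * (q : ℝ) ^ 2)) := by gcongr
        _ = 1 / (2 * q) := by field_simp
    rw [abs_mul, abs_of_pos (by positivity)]
    calc 2 * ((j : ℝ) + 1) * |q * δ| ≤ 2 * (j + 1) * (1 / (2 * q)) := by gcongr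
      _ = (j + 1) / q := by field_simp
      _ < 1 := by rw [div_lt_one hQ]; linarith
  obtain ⟨ha, hb⟩ := abs_lt.mp hsmall
  have key : q * (2 * ((j + 1 : ℕ) * θ)) = q * z + r + 2 * (j + 1) * (q * δ) := by
    push_cast
    linear_combination 2 * ((j : ℝ) + 1) * hθδ - h1'
  constructor
  · refine lt_of_mul_lt_mul_left ?_ hQ.le
    rw [key]
    linarith
  · refine lt_of_mul_lt_mul_left ?_ hQ.le
    rw [key]
    linarith

theorem discSum_succ_eq_one_add (θ : ℝ) (n : ℕ) :
    discSum θ 0 (n + 1) = 1 + ∑ j ∈ Finset.range n, halfSign ((j + 1 : ℕ) * θ) := by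
  rw [discSum, Finset.sum_range_succ', add_comm]
  simp [halfSign]

theorem discSum_succ_of_near {p : ℤ} {q n : ℕ} {θ : ℝ} (hq : Odd (q : ℤ))
    (hpq : IsCoprime p (q : ℤ)) (hθ : |θ - p / q| ≤ 1 / (2 * (q : ℝ) ^ 2)) (hn : n < q) :
    discSum θ 0 (n + 1) = 1 + ratSum p q n := by
  rw [discSum_succ_eq_one_add, ratSum]
  congr 1
  refine Finset.sum_congr rfl fun j hj => ?_
  have hj' := Finset.mem_range.mp hj
  obtain ⟨h1, h2⟩ := floor_two_mul_of_near hq hpq hθ (j := j) (by omega)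
  rw [halfSign_eq_paritySign, Int.floor_eq_iff.mpr ⟨h1.le, h2⟩, ratSign]

/-! ### Fractions with bounded sums, and their refinement. -/

/-- A reduced fraction `num / den` with odd denominator, together with bounds for the partial sums
`ratSum num den n` over the first period. -/
structure OddRat where
  num : ℤ
  den : ℕ
  up : ℕ
  low : ℕ
  odd : Odd (den : ℤ)
  coprime : IsCoprime num (den : ℤ)
  le_up : ∀ n < den, ratSum num den n ≤ up
  neg_low_le : ∀ n < den, -(low : ℤ) ≤ ratSum num den n

namespace OddRat

/-- The neighbourhood of `num / den` on which the first `den` discrepancy sums are constant. -/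
def nhd (x : OddRat) : Set ℝ := {θ | |θ - x.num / x.den| ≤ 1 / (2 * (x.den : ℝ) ^ 2)}

/-- The fraction `-num / den`. -/
def reflect (x : OddRat) : OddRat where
  num := -x.num
  den := x.den
  up := x.low
  low := x.up
  odd := x.odd
  coprime := x.coprime.neg_left
  le_up n hn := by
    rw [ratSum_neg x.odd x.coprime hn]
    linarith [x.neg_low_le n hn]
  neg_low_le n hn := by
    rw [ratSum_neg x.odd x.coprime hn]
    linarith [x.le_up n hn]

theorem den_pos (x : OddRat) : 0 < x.den := by
  have := x.odd
  rcases Nat.eq_zero_or_pos x.den with h | h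
  · simp [h] at this
  · exact h

theorem reflect_reflect (x : OddRat) : x.reflect.reflect = x := by
  simp [reflect]

theorem mem_nhd_reflect {x : OddRat} {θ : ℝ} : θ ∈ x.reflect.nhd ↔ -θ ∈ x.nhd := by
  have : θ - ((-x.num : ℤ) : ℝ) / x.den = -(-θ - x.num / x.den) := by
    push_cast
    ring
  simp only [nhd, reflect, Set.mem_ofPred_eq, this, abs_neg]

theorem reflect_nhd_subset {x y : OddRat} (h : y.nhd ⊆ x.nhd) : y.reflect.nhd ⊆ x.reflect.nhd :=
  fun _ hθ => mem_nhd_reflect.mpr (h (mem_nhd_reflect.mp hθ))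

theorem ratSum_reflect (x : OddRat) {n : ℕ} (hn : n < x.den) :
    ratSum x.reflect.num x.reflect.den n = -ratSum x.num x.den n :=
  ratSum_neg x.odd x.coprime hn

theorem ratSum_le (x : OddRat) (n : ℕ) : ratSum x.num x.den n ≤ x.up + (n / x.den : ℕ) := by
  rw [ratSum_eq_div_add_mod x.odd x.coprime]
  linarith [x.le_up (n % x.den) (Nat.mod_lt _ x.den_pos)]

theorem le_ratSum (x : OddRat) (n : ℕ) : -(x.low : ℤ) ≤ ratSum x.num x.den n := by
  rw [ratSum_eq_div_add_mod x.odd x.coprime]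
  have := x.neg_low_le (n % x.den) (Nat.mod_lt _ x.den_pos)
  have : (0 : ℤ) ≤ (n / x.den : ℕ) := Int.natCast_nonneg _
  linarith

theorem odd_of_det {p' m : ℤ} {q : ℤ} (hdet : p' * q - 2 * m = 1) : Odd p' := by
  have : Odd (p' * q) := ⟨m, by linarith⟩
  exact (Int.odd_mul.mp this).1

section LeftSum

variable {p' : ℤ} {h : ℕ} (x : OddRat)

theorem leftSum_bounds_of_lt (hdet : p' * x.den - 2 * h * x.num = 1) {n : ℕ} (hn : n < 2 * h) :
    -(x.low : ℤ) ≤ leftSum p' h n ∧ leftSum p' h n ≤ x.up + 1 + (h / x.den : ℕ) := by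
  have hp' : Odd p' := odd_of_det (m := h * x.num) (q := x.den) (by linarith)
  have hcop : IsCoprime p' (h : ℤ) := ⟨x.den, -2 * x.num, by linarith⟩
  rcases le_or_gt n h with hnh | hnh
  · rw [leftSum_eq_ratSum x.den_pos hdet hnh]
    have h1 := x.le_ratSum n
    have h2 := x.ratSum_le n
    have h3 := Nat.div_le_div_right (c := x.den) hnh
    omega
  · obtain ⟨i, rfl⟩ := Nat.exists_eq_add_of_le hnh.le
    rw [leftSum_half_add hp' hcop (by omega), leftSum_eq_ratSum x.den_pos hdet (by omega)]
    have h1 := x.le_ratSum (h - 1 - i)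
    have h2 := x.ratSum_le (h - 1 - i)
    have h3 : (h - 1 - i) / x.den ≤ h / x.den := Nat.div_le_div_right (by omega)
    omega

theorem leftSum_bounds (hdet : p' * x.den - 2 * h * x.num = 1) (hh : 0 < h) (n : ℕ) :
    -(x.low : ℤ) ≤ leftSum p' h n ∧ leftSum p' h n ≤ x.up + 1 + (h / x.den : ℕ) := by
  have hp' : Odd p' := odd_of_det (m := h * x.num) (q := x.den) (by linarith)
  rw [leftSum_mod hp' hh]
  exact x.leftSum_bounds_of_lt hdet (Nat.mod_lt _ (by omega))

/-- Neither new bound depends on `k`, so `k` can be chosen after them to make the denominator as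
large as needed. -/
theorem exists_refine (hdet : p' * x.den - 2 * h * x.num = 1) (hh : 2 * x.den ≤ h) {k : ℕ}
    (hk : 1 ≤ k) :
    ∃ y : OddRat, y.den = k * (2 * h) + x.den ∧ y.up = x.up + 1 + h ∧ y.low = x.low ∧
      y.nhd ⊆ x.nhd ∧ ∀ n < y.den, ratSum y.num y.den n = leftSum p' h n := by
  have hx := x.den_pos
  have hdet' : p' * (k * (2 * h) + x.den : ℕ) - 2 * h * (k * p' + x.num) = 1 := by
    push_cast
    linear_combination hdet
  have heq : ∀ n < k * (2 * h) + x.den,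
      ratSum (k * p' + x.num) (k * (2 * h) + x.den) n = leftSum p' h n := fun n hn =>
    ratSum_eq_leftSum (by omega) hdet' hn
  have hdiv := Nat.div_le_self h x.den
  refine ⟨⟨k * p' + x.num, k * (2 * h) + x.den, x.up + 1 + h, x.low, ?_, ?_, ?_, ?_⟩,
    rfl, rfl, rfl, ?_, heq⟩
  · have : ((k * (2 * h) + x.den : ℕ) : ℤ) = 2 * (k * h) + x.den := by push_cast; ring
    rw [this]
    exact (even_two_mul _).add_odd x.odd
  · exact ⟨-2 * h, p', by linarith⟩
  · intro n hn
    rw [heq n hn]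
    have := (x.leftSum_bounds hdet (by omega) n).2
    push_cast
    omega
  · intro n hn
    rw [heq n hn]
    exact (x.leftSum_bounds hdet (by omega) n).1
  · intro θ hθ
    simp only [nhd, Set.mem_ofPred_eq] at hθ ⊢
    have hQ : (0 : ℝ) < x.den := by exact_mod_cast hx
    have hH : 2 * (x.den : ℝ) ≤ h := by exact_mod_cast hh
    have hK : (1 : ℝ) ≤ k := by exact_mod_cast hk
    have hdetR : p' * (x.den : ℝ) - 2 * h * x.num = 1 := by exact_mod_cast hdet
    set q : ℝ := (x.den : ℝ)
    set Q : ℝ := ((k * (2 * h) + x.den : ℕ) : ℝ) with hQdef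
    have hQeq : Q = k * (2 * h) + q := by rw [hQdef]; push_cast; rfl
    have hQ4 : k * (4 * q) ≤ Q := by
      rw [hQeq]
      have : (k : ℝ) * (4 * q) ≤ k * (2 * h) :=
        mul_le_mul_of_nonneg_left (by linarith) (by positivity)
      linarith
    have hQ4' : 4 * q ≤ Q := le_trans (by nlinarith) hQ4
    have hQpos : 0 < Q := by linarith
    have hdist : ((k * p' + x.num : ℤ) : ℝ) / Q - x.num / q = k / (q * Q) := by
      rw [div_sub_div _ _ hQpos.ne' hQ.ne', mul_comm Q q]
      congr 1
      push_cast
      rw [hQeq]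
      linear_combination k * hdetR
    -- Half of the old radius pays for the shift of the centre, the other half for the new radius.
    have h1 : (k : ℝ) / (q * Q) ≤ 1 / (4 * q ^ 2) := by
      rw [div_le_div_iff₀ (by positivity) (by positivity)]
      calc (k : ℝ) * (4 * q ^ 2) = q * (k * (4 * q)) := by ring
        _ ≤ q * Q := by gcongr
        _ = 1 * (q * Q) := by ring
    have h2 : 1 / (2 * Q ^ 2) ≤ 1 / (4 * q ^ 2) := by
      apply one_div_le_one_div_of_le (by positivity)
      nlinarith
    calc |θ - x.num / q|
        = |(θ - ((k * p' + x.num : ℤ) : ℝ) / Q) + k / (q * Q)| := by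
          rw [← hdist]
          congr 1
          ring
      _ ≤ |θ - ((k * p' + x.num : ℤ) : ℝ) / Q| + |k / (q * Q)| := abs_add_le _ _
      _ ≤ 1 / (4 * q ^ 2) + 1 / (4 * q ^ 2) := by
          rw [abs_of_nonneg (show 0 ≤ (k : ℝ) / (q * Q) by positivity)]
          exact add_le_add (hθ.trans h2) h1
      _ = 1 / (2 * q ^ 2) := by field_simp; norm_num

end LeftSum

/-- The condition on `h` is a congruence modulo `x.den` with `2 * x.num` invertible, so every window
of `x.den` consecutive integers contains a solution. -/
theorem exists_det (x : OddRat) {N : ℕ} (hN : x.den ≤ N) :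
    ∃ (h : ℕ) (p' : ℤ), h ≤ N ∧ N < h + x.den ∧ p' * x.den - 2 * h * x.num = 1 := by
  have h2 : IsCoprime (2 : ℤ) x.den := by
    obtain ⟨m, hm⟩ := x.odd
    exact ⟨-m, 1, by rw [hm]; ring⟩
  obtain ⟨u, v, huv⟩ := h2.mul_left x.coprime
  have hq : (0 : ℤ) < x.den := by exact_mod_cast x.den_pos
  have e1 := Int.emod_add_mul_ediv ((N : ℤ) + u) x.den
  have e2 := Int.emod_nonneg ((N : ℤ) + u) hq.ne'
  have e3 := Int.emod_lt_of_pos ((N : ℤ) + u) hq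
  set r := ((N : ℤ) + u) % x.den
  set t := ((N : ℤ) + u) / x.den
  refine ⟨(N - r).toNat, v + 2 * t * x.num, by omega, by omega, ?_⟩
  rw [Int.toNat_of_nonneg (by omega)]
  linear_combination huv + 2 * x.num * e1

end OddRat

/-! ### One climb up to `c`, or descent to `-d`. -/

namespace OddRat

theorem exists_rise (x : OddRat) {c : ℕ → ℝ} (hmono : Monotone c)
    (ho : c =o[atTop] (fun n : ℕ => (n : ℝ))) (hx : (x.up : ℝ) + 5 ≤ c x.den) :
    ∃ (h : ℕ) (p' : ℤ), 2 * x.den ≤ h ∧ p' * x.den - 2 * h * x.num = 1 ∧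
      (∀ n, x.den ≤ n → (leftSum p' h n : ℝ) ≤ c n) ∧
      ∃ n, x.den ≤ n ∧ n ≤ h ∧ c (n + 2) - x.up - 4 ≤ leftSum p' h n := by
  have hq := x.den_pos
  have hQ : (0 : ℝ) < x.den := by exact_mod_cast hq
  have hex : ∃ n : ℕ, x.den ≤ n ∧ c n < (n : ℝ) / x.den + x.up + 1 := by
    obtain ⟨n, hn, hqn⟩ := ((ho.def (one_div_pos.mpr hQ)).and (eventually_ge_atTop x.den)).exists
    refine ⟨n, hqn, ?_⟩
    rw [Real.norm_natCast] at hn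
    have h1 := (le_abs_self _).trans hn
    have h2 : 1 / (x.den : ℝ) * n = n / x.den := by ring
    have h3 : (0 : ℝ) ≤ x.up := Nat.cast_nonneg _
    linarith
  -- `N` is the first crossing time: before it the sums stay below `c`, and the `+ 1` leaves room
  -- for the shift in the retraced half-period.
  obtain ⟨N, ⟨hqN, hcN⟩, hmin⟩ : ∃ N : ℕ, (x.den ≤ N ∧ c N < (N : ℝ) / x.den + x.up + 1) ∧
      ∀ n < N, x.den ≤ n → (n : ℝ) / x.den + x.up + 1 ≤ c n := by
    classical
    refine ⟨Nat.find hex, Nat.find_spec hex, fun n hn hqn => ?_⟩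
    have := Nat.find_min hex hn
    by_contra! hc
    exact this ⟨hqn, hc⟩
  have hN4 : 4 * x.den < N := by
    have h1 := hmono hqN
    have h2 : (4 : ℝ) < N / x.den := by linarith
    rw [lt_div_iff₀ hQ] at h2
    exact_mod_cast h2
  obtain ⟨h, p', hhN, hNh, hdet⟩ := x.exists_det (N := N - 2) (by omega)
  have hhR : (0 : ℝ) ≤ (h / x.den : ℕ) := by positivity
  -- The near-maximum is taken at the last multiple of `x.den` up to `h`, where the sum is exactly
  -- the number of periods. As `h ≤ N - 2`, the value `c (n + 2)` is still at most `c N`.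
  refine ⟨h, p', by omega, hdet, fun n hn => ?_, h / x.den * x.den, ?_, Nat.div_mul_le_self _ _, ?_⟩
  · rcases le_or_gt n h with hnh | hnh
    · have h1 := hmin n (by omega) hn
      have h2 : (leftSum p' h n : ℝ) ≤ x.up + (n / x.den : ℕ) := by
        rw [leftSum_eq_ratSum hq hdet hnh]
        have := (Int.cast_le (R := ℝ)).mpr (x.ratSum_le n)
        simpa only [Int.cast_add, Int.cast_natCast] using this
      have h3 : ((n / x.den : ℕ) : ℝ) ≤ n / x.den := Nat.cast_div_le
      linarith
    · have h1 := hmin h (by omega) (by omega)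
      have h2 : (leftSum p' h n : ℝ) ≤ x.up + 1 + (h / x.den : ℕ) := by
        have := (Int.cast_le (R := ℝ)).mpr (x.leftSum_bounds hdet (by omega) n).2
        simpa only [Int.cast_add, Int.cast_natCast, Int.cast_one] using this
      have h3 : ((h / x.den : ℕ) : ℝ) ≤ h / x.den := Nat.cast_div_le
      have h4 := hmono hnh.le
      linarith
  · have : 1 ≤ h / x.den := (Nat.one_le_div_iff hq).mpr (by omega)
    nlinarith
  · rw [leftSum_eq_ratSum hq hdet (Nat.div_mul_le_self _ _), ratSum_mul_period x.odd x.coprime]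
    have h1 : c (h / x.den * x.den + 2) ≤ c N := hmono (by
      have := Nat.div_mul_le_self h x.den
      omega)
    have h2 : (N : ℝ) < (h / x.den : ℕ) * x.den + 3 * x.den := by
      have e1 := Nat.div_add_mod' h x.den
      have e2 := Nat.mod_lt h hq
      exact_mod_cast (by omega : N < h / x.den * x.den + 3 * x.den)
    have h3 : (N : ℝ) / x.den < (h / x.den : ℕ) + 3 := by
      rw [div_lt_iff₀ hQ]
      linarith
    rw [Int.cast_natCast]
    linarith

/-- If `c` diverges, it has outgrown the bound `a` by the factor `s + 1` at time `q`. -/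
def Outgrown (c : ℕ → ℝ) (s a q : ℕ) : Prop :=
  Tendsto c atTop atTop → ((s : ℝ) + 1) * (a + 5) ≤ c q

theorem eventually_outgrown (c : ℕ → ℝ) (s a : ℕ) : ∀ᶠ q in atTop, Outgrown c s a q := by
  by_cases hc : Tendsto c atTop atTop
  · filter_upwards [hc.eventually_ge_atTop (((s : ℝ) + 1) * (a + 5))] with q hq _ using hq
  · exact Eventually.of_forall fun _ h => absurd h hc

theorem Outgrown.add_five_le {c : ℕ → ℝ} {s a q : ℕ} (h : Outgrown c s a q)
    (hc : Tendsto c atTop atTop) : (a : ℝ) + 5 ≤ c q := by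
  refine le_trans ?_ (h hc)
  have : (0 : ℝ) ≤ s * (a + 5) := by positivity
  linarith

/-- `y` refines `x`, and between the times `x.den` and `y.den` its discrepancy sums respect the
bounds given by the divergent ones among `c` and `d`. -/
structure IsRefinement (c d : ℕ → ℝ) (x y : OddRat) : Prop where
  nhd_subset : y.nhd ⊆ x.nhd
  den_lt : x.den < y.den
  le_upper : Tendsto c atTop atTop →
    ∀ n, x.den ≤ n → n < y.den → (ratSum y.num y.den n : ℝ) ≤ c n
  neg_le_lower : Tendsto d atTop atTop →
    ∀ n, x.den ≤ n → n < y.den → -(ratSum y.num y.den n : ℝ) ≤ d n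

/-- Between the times `x.den` and `y.den` the discrepancy sums of `y` come close to `c`, while
their lower bound is that of `x`. -/
def Rises (c : ℕ → ℝ) (s : ℕ) (x y : OddRat) : Prop :=
  y.low = x.low ∧ ∃ n, x.den ≤ n ∧ n < y.den ∧
    (1 - 1 / ((s : ℝ) + 1)) * c (n + 2) ≤ ratSum y.num y.den n

theorem IsRefinement.reflect {c d : ℕ → ℝ} {x y : OddRat} (h : IsRefinement c d x y) :
    IsRefinement d c x.reflect y.reflect where
  nhd_subset := reflect_nhd_subset h.nhd_subset
  den_lt := h.den_lt
  le_upper hd n hxn hny := by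
    rw [ratSum_reflect y hny]
    push_cast
    exact h.neg_le_lower hd n hxn hny
  neg_le_lower hc n hxn hny := by
    rw [ratSum_reflect y hny]
    push_cast
    rw [neg_neg]
    exact h.le_upper hc n hxn hny

theorem exists_rising_refinement (x : OddRat) {c d : ℕ → ℝ} {s : ℕ} (hc_mono : Monotone c)
    (hd_mono : Monotone d) (ho : c =o[atTop] (fun n : ℕ => (n : ℝ)))
    (hc : Tendsto c atTop atTop) (hxc : Outgrown c s x.up x.den)
    (hxd : Outgrown d s x.low x.den) :
    ∃ y : OddRat, Outgrown c (s + 1) y.up y.den ∧ Outgrown d (s + 1) y.low y.den ∧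
      IsRefinement c d x y ∧ Rises c s x y := by
  obtain ⟨h, p', hh, hdet, hle, n, hqn, hnh, hn⟩ :=
    x.exists_rise hc_mono ho (hxc.add_five_le hc)
  obtain ⟨K, hK⟩ := eventually_atTop.mp
    ((eventually_outgrown c (s + 1) (x.up + 1 + h)).and (eventually_outgrown d (s + 1) x.low))
  have hx := x.den_pos
  obtain ⟨y, hden, hup, hlow, hsub, hsum⟩ :=
    x.exists_refine hdet hh (k := K + 1) (by omega)
  have hKy : K + 1 ≤ (K + 1) * (2 * h) := Nat.le_mul_of_pos_right _ (by omega)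
  have hhy : 2 * h ≤ (K + 1) * (2 * h) := Nat.le_mul_of_pos_left _ (by omega)
  refine ⟨y, ?_, ?_, ⟨hsub, by omega, fun _ m hm hmy => ?_, fun hd m hm hmy => ?_⟩, hlow, n, hqn,
    by omega, ?_⟩
  · rw [hup]
    exact (hK _ (by omega)).1
  · rw [hlow]
    exact (hK _ (by omega)).2
  · rw [hsum m hmy]
    exact hle m hm
  · have h1 : -(x.low : ℝ) ≤ ratSum y.num y.den m := by
      rw [hsum m hmy]
      exact_mod_cast (x.leftSum_bounds hdet (by omega) m).1
    have h2 := hxd.add_five_le hd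
    have h3 := hd_mono hm
    linarith
  · rw [hsum n (by omega)]
    refine le_trans ?_ hn
    have h1 := hxc hc
    have h2 := hc_mono (hqn.trans (Nat.le_add_right n 2))
    -- The additive loss `x.up + 4` is at most the fraction `1 / (s + 1)` of `c (n + 2)`.
    have h3 : (x.up : ℝ) + 5 ≤ c (n + 2) / (s + 1) := by
      rw [le_div_iff₀ (by positivity)]
      linarith
    have h4 : (1 - 1 / ((s : ℝ) + 1)) * c (n + 2) = c (n + 2) - c (n + 2) / (s + 1) := by ring
    linarith

theorem exists_falling_refinement (x : OddRat) {c d : ℕ → ℝ} {s : ℕ} (hc_mono : Monotone c)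
    (hd_mono : Monotone d) (ho : d =o[atTop] (fun n : ℕ => (n : ℝ)))
    (hd : Tendsto d atTop atTop) (hxc : Outgrown c s x.up x.den)
    (hxd : Outgrown d s x.low x.den) :
    ∃ y : OddRat, Outgrown c (s + 1) y.up y.den ∧ Outgrown d (s + 1) y.low y.den ∧
      IsRefinement c d x y ∧ Rises d s x.reflect y.reflect := by
  obtain ⟨y, hyd, hyc, href, hrise⟩ :=
    x.reflect.exists_rising_refinement hd_mono hc_mono ho hd hxd hxc
  refine ⟨y.reflect, hyc, hyd, ?_, ?_⟩
  · simpa [reflect_reflect] using href.reflect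
  · simpa [reflect_reflect] using hrise

theorem abs_ratSum_le (p : ℤ) (q n : ℕ) : |ratSum p q n| ≤ n := by
  refine (Finset.abs_sum_le_sum_abs _ _).trans ?_
  refine (Finset.sum_le_card_nsmul _ _ 1 fun j _ => ?_).trans (by simp)
  unfold ratSign paritySign
  split_ifs <;> simp

theorem exists_nhd_subset {u v : ℝ} (huv : u < v) : ∃ x : OddRat, x.nhd ⊆ Set.Ioo u v := by
  obtain ⟨m, hm⟩ := exists_nat_gt (4 / (v - u))
  obtain ⟨q, hqm, hqp⟩ := Nat.exists_infinite_primes (m + 3)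
  have hq0 : (0 : ℝ) < q := by exact_mod_cast hqp.pos
  have hqm' : (m : ℝ) + 3 ≤ q := by exact_mod_cast hqm
  have hq : 4 < q * (v - u) := by
    rw [div_lt_iff₀ (sub_pos.mpr huv)] at hm
    nlinarith
  obtain ⟨p, hpq, hpu, hpv⟩ : ∃ p : ℤ, ¬ (q : ℤ) ∣ p ∧ (u + v) / 2 * q - 1 ≤ p ∧
      p ≤ (u + v) / 2 * q + 1 := by
    have h1 := Int.floor_le ((u + v) / 2 * q)
    have h2 := Int.lt_floor_add_one ((u + v) / 2 * q)
    by_cases hd : (q : ℤ) ∣ ⌊(u + v) / 2 * q⌋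
    · refine ⟨⌊(u + v) / 2 * q⌋ + 1, fun hd' => ?_, ?_, ?_⟩
      · have := Int.le_of_dvd one_pos ((dvd_add_right hd).mp hd')
        omega
      · push_cast
        linarith
      · push_cast
        linarith
    · exact ⟨_, hd, by linarith, by linarith⟩
  have hcop : IsCoprime p (q : ℤ) :=
    ((Nat.prime_iff_prime_int.mp hqp).irreducible.coprime_iff_not_dvd.mpr hpq).symm
  have hodd : Odd (q : ℤ) := by exact_mod_cast hqp.odd_of_ne_two (by omega)
  refine ⟨⟨p, q, q, q, hodd, hcop, fun n hn => ?_, fun n hn => ?_⟩, fun θ hθ => ?_⟩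
  · have := (abs_le.mp (abs_ratSum_le p q n)).2
    omega
  · have := (abs_le.mp (abs_ratSum_le p q n)).1
    omega
  · simp only [nhd, Set.mem_ofPred_eq] at hθ
    have h1 : |q * θ - p| ≤ 1 := by
      have : q * θ - p = q * (θ - p / q) := by field_simp
      rw [this, abs_mul, abs_of_pos hq0]
      calc q * |θ - p / q| ≤ q * (1 / (2 * (q : ℝ) ^ 2)) := by gcongr
        _ = 1 / (2 * q) := by field_simp
        _ ≤ 1 := by rw [div_le_one (by positivity)]; linarith [(Nat.cast_nonneg m : (0 : ℝ) ≤ m)]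
    obtain ⟨h2, h3⟩ := abs_le.mp h1
    constructor <;> refine lt_of_mul_lt_mul_left ?_ hq0.le <;> linarith

/-- One refinement with huge `k` enlarges the denominator while the bounds stay fixed, so that
divergent `c` and `d` outgrow them. -/
theorem exists_initial {u v : ℝ} (huv : u < v) (c d : ℕ → ℝ) :
    ∃ x : OddRat, x.nhd ⊆ Set.Ioo u v ∧ Outgrown c 0 x.up x.den ∧ Outgrown d 0 x.low x.den := by
  obtain ⟨x, hx⟩ := exists_nhd_subset huv
  have hx0 := x.den_pos
  obtain ⟨h, p', -, hh, hdet⟩ := x.exists_det (N := 3 * x.den) (by omega)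
  obtain ⟨K, hK⟩ := eventually_atTop.mp
    ((eventually_outgrown c 0 (x.up + 1 + h)).and (eventually_outgrown d 0 x.low))
  obtain ⟨y, hden, hup, hlow, hsub, -⟩ :=
    x.exists_refine hdet (by omega) (k := K + 1) (by omega)
  have hKy : K + 1 ≤ (K + 1) * (2 * h) := Nat.le_mul_of_pos_right _ (by omega)
  refine ⟨y, hsub.trans hx, ?_, ?_⟩
  · rw [hup]
    exact (hK _ (by omega)).1
  · rw [hlow]
    exact (hK _ (by omega)).2

end OddRat

/-! ### Nested refinements and the limit angle. -/

namespace OddRat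

theorem exists_refinement_seq {c d : ℕ → ℝ} (hc_mono : Monotone c) (hd_mono : Monotone d)
    (hc_o : c =o[atTop] (fun n : ℕ => (n : ℝ))) (hd_o : d =o[atTop] (fun n : ℕ => (n : ℝ)))
    (rising : ℕ → Prop) (hrc : ∀ s, rising s → Tendsto c atTop atTop)
    (hrd : ∀ s, ¬ rising s → Tendsto d atTop atTop) (x : OddRat)
    (hxc : Outgrown c 0 x.up x.den) (hxd : Outgrown d 0 x.low x.den) :
    ∃ X : ℕ → OddRat, X 0 = x ∧ ∀ s, IsRefinement c d (X s) (X (s + 1)) ∧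
      (rising s → Rises c s (X s) (X (s + 1))) ∧
      (¬ rising s → Rises d s (X s).reflect (X (s + 1)).reflect) := by
  have step : ∀ s (x : {x : OddRat // Outgrown c s x.up x.den ∧ Outgrown d s x.low x.den}),
      ∃ y : {x : OddRat // Outgrown c (s + 1) x.up x.den ∧ Outgrown d (s + 1) x.low x.den},
        IsRefinement c d x.1 y.1 ∧ (rising s → Rises c s x.1 y.1) ∧
        (¬ rising s → Rises d s x.1.reflect y.1.reflect) := by
    rintro s ⟨x, hxc, hxd⟩
    by_cases hs : rising s
    · obtain ⟨y, hyc, hyd, href, hrise⟩ :=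
        x.exists_rising_refinement hc_mono hd_mono hc_o (hrc s hs) hxc hxd
      exact ⟨⟨y, hyc, hyd⟩, href, fun _ => hrise, fun h => absurd hs h⟩
    · obtain ⟨y, hyc, hyd, href, hfall⟩ :=
        x.exists_falling_refinement hc_mono hd_mono hd_o (hrd s hs) hxc hxd
      exact ⟨⟨y, hyc, hyd⟩, href, fun h => absurd h hs, fun _ => hfall⟩
  choose next hnext using step
  let X : (s : ℕ) → {x : OddRat // Outgrown c s x.up x.den ∧ Outgrown d s x.low x.den} :=
    fun s => Nat.rec ⟨x, hxc, hxd⟩ next s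
  exact ⟨fun s => (X s).1, rfl, fun s => hnext s (X s)⟩

theorem nhd_eq_closedBall (x : OddRat) :
    x.nhd = Metric.closedBall (x.num / x.den : ℝ) (1 / (2 * (x.den : ℝ) ^ 2)) := by
  ext θ
  simp [nhd, Real.dist_eq]

theorem nhd_nonempty (x : OddRat) : x.nhd.Nonempty := by
  rw [nhd_eq_closedBall]
  exact Metric.nonempty_closedBall.mpr (by positivity)

theorem discSum_succ (x : OddRat) {θ : ℝ} (hθ : θ ∈ x.nhd) {n : ℕ} (hn : n < x.den) :
    discSum θ 0 (n + 1) = 1 + ratSum x.num x.den n :=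
  discSum_succ_of_near x.odd x.coprime hθ hn

/-- For a rational `r` the number `2 * r.den * r` is an integer, yet once `(X s).den` exceeds
`r.den` it lies strictly between consecutive integers. -/
theorem irrational_of_mem_nhd {X : ℕ → OddRat} {θ : ℝ} (hθ : ∀ s, θ ∈ (X s).nhd)
    (hX : ∀ n, ∃ s, n < (X s).den) : Irrational θ := by
  rintro ⟨r, rfl⟩
  obtain ⟨s, hs⟩ := hX r.den
  obtain ⟨j, hj⟩ := Nat.exists_eq_succ_of_ne_zero r.den_nz
  rw [hj] at hs
  obtain ⟨h1, h2⟩ := floor_two_mul_of_near (X s).odd (X s).coprime (hθ s) hs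
  have h3 : 2 * ((j + 1 : ℕ) * (r : ℝ)) = (2 * r.num : ℤ) := by
    have : ((r.den : ℚ) * r : ℚ) = r.num := Rat.den_mul_eq_num r
    rw [hj] at this
    push_cast
    have h4 : (((j.succ : ℕ) : ℚ) * r : ℝ) = r.num := by exact_mod_cast this
    push_cast at h4
    rw [h4]
  rw [h3] at h1 h2
  norm_cast at h1 h2
  omega

theorem eventually_le_of_refinements {X : ℕ → OddRat} {T : ℕ → ℤ} {c : ℕ → ℝ}
    (hX : StrictMono fun s => (X s).den)
    (hT : ∀ s, ∀ n < (X s).den, T n = ratSum (X s).num (X s).den n)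
    (hle : ∀ s n, (X s).den ≤ n → n < (X (s + 1)).den →
      (ratSum (X (s + 1)).num (X (s + 1)).den n : ℝ) ≤ c n) :
    ∀ᶠ n in atTop, (T n : ℝ) ≤ c n := by
  filter_upwards [eventually_ge_atTop (X 0).den] with n hn
  have hex : ∃ s, n < (X s).den := ⟨n + 1, hX.le_apply (x := n + 1)⟩
  classical
  have hs := Nat.find_spec hex
  have hmin := fun m => Nat.find_min hex (m := m)
  rcases hf : Nat.find hex with _ | s
  · rw [hf] at hs
    omega
  · rw [hf] at hs hmin
    rw [hT _ n hs]
    exact hle s n (not_lt.mp (hmin s (Nat.lt_succ_self s))) hs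

theorem frequently_ge_of_rises {X : ℕ → OddRat} {T : ℕ → ℤ} {c : ℕ → ℝ} (hc : ∀ n, 0 < c n)
    (hX : StrictMono fun s => (X s).den)
    (hT : ∀ s, ∀ n < (X s).den, T n = ratSum (X s).num (X s).den n)
    (hrise : ∃ᶠ s in atTop, Rises c s (X s) (X (s + 1))) {ε : ℝ} (hε : 0 < ε) :
    ∃ᶠ n in atTop, (1 - ε) * c (n + 2) ≤ T n := by
  rw [frequently_atTop]
  intro N
  obtain ⟨M, hM⟩ := exists_nat_one_div_lt hε
  obtain ⟨s, hs, -, n, hsn, hns, hn⟩ := frequently_atTop.mp hrise (max M N)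
  refine ⟨n, ?_, ?_⟩
  · have : s ≤ (X s).den := hX.le_apply
    exact (le_max_right M N).trans (hs.trans (this.trans hsn))
  · rw [hT _ n hns]
    refine le_trans (mul_le_mul_of_nonneg_right ?_ (hc _).le) hn
    have h1 : (M : ℝ) ≤ s := by exact_mod_cast (le_max_left M N).trans hs
    have h2 : 1 / ((s : ℝ) + 1) ≤ 1 / ((M : ℝ) + 1) := by gcongr
    linarith

theorem le_of_rises {X : ℕ → OddRat} {T : ℕ → ℤ} {c : ℕ → ℝ}
    (hX : StrictMono fun s => (X s).den)
    (hT : ∀ s, ∀ n < (X s).den, T n = ratSum (X s).num (X s).den n)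
    (hrise : ∀ s, Rises c s (X s) (X (s + 1))) (n : ℕ) : -T n ≤ (X 0).low := by
  have hlow : ∀ s, (X s).low = (X 0).low := fun s => by
    induction s with
    | zero => rfl
    | succ s ih => rw [(hrise s).1, ih]
  have hn : n < (X (n + 1)).den := hX.le_apply (x := n + 1)
  rw [hT _ n hn, ← hlow (n + 1)]
  linarith [(X (n + 1)).neg_low_le n hn]

end OddRat

open OddRat in
/-- In every open interval there is an irrational angle whose discrepancy sums `T n` up to time
`n + 1`, minus one, are eventually bounded by `c` above and by `-d` below, both bounds being
asymptotically attained when they diverge, and are bounded on each side whose bound does not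
diverge. -/
theorem exists_angle {c d : ℕ → ℝ} (hc_pos : ∀ n, 0 < c n) (hd_pos : ∀ n, 0 < d n)
    (hc_mono : Monotone c) (hd_mono : Monotone d)
    (hc_o : c =o[atTop] (fun n : ℕ => (n : ℝ))) (hd_o : d =o[atTop] (fun n : ℕ => (n : ℝ)))
    (hdiv : Tendsto c atTop atTop ∨ Tendsto d atTop atTop) {u v : ℝ} (huv : u < v) :
    ∃ θ ∈ Set.Ioo u v, Irrational θ ∧ ∃ T : ℕ → ℤ, (∀ n, discSum θ 0 (n + 1) = 1 + T n) ∧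
      (Tendsto c atTop atTop → (∀ᶠ n in atTop, (T n : ℝ) ≤ c n) ∧
        ∀ ε > 0, ∃ᶠ n in atTop, (1 - ε) * c (n + 2) ≤ T n) ∧
      (¬ Tendsto c atTop atTop → ∃ K : ℤ, ∀ n, T n ≤ K) ∧
      (Tendsto d atTop atTop → (∀ᶠ n in atTop, ((-T n : ℤ) : ℝ) ≤ d n) ∧
        ∀ ε > 0, ∃ᶠ n in atTop, (1 - ε) * d (n + 2) ≤ ((-T n : ℤ) : ℝ)) ∧
      (¬ Tendsto d atTop atTop → ∃ K : ℤ, ∀ n, -T n ≤ K) := by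
  obtain ⟨x, hx, hxc, hxd⟩ := exists_initial huv c d
  -- Climbs and descents alternate with the parity of `s` if both bounds diverge; otherwise every
  -- step serves the divergent one, and the opposite bound never changes.
  obtain ⟨X, rfl, hX⟩ := exists_refinement_seq hc_mono hd_mono hc_o hd_o
    (fun s => Tendsto c atTop atTop ∧ (Even s ∨ ¬ Tendsto d atTop atTop))
    (fun s hs => hs.1) (fun s hs => by tauto) x hxc hxd
  have hden : StrictMono fun s => (X s).den := strictMono_nat_of_lt_succ fun s => (hX s).1.den_lt
  obtain ⟨θ, hθ⟩ := IsCompact.nonempty_iInter_of_sequence_nonempty_isCompact_isClosed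
    (fun s => (X s).nhd) (fun s => (hX s).1.nhd_subset) (fun s => (X s).nhd_nonempty)
    (by rw [nhd_eq_closedBall]; exact isCompact_closedBall _ _)
    (fun s => by rw [nhd_eq_closedBall]; exact Metric.isClosed_closedBall)
  rw [Set.mem_iInter] at hθ
  have hex : ∀ n, ∃ s, n < (X s).den := fun n => ⟨n + 1, hden.le_apply (x := n + 1)⟩
  let T : ℕ → ℤ := fun n => discSum θ 0 (n + 1) - 1
  have hT : ∀ s, ∀ n < (X s).den, T n = ratSum (X s).num (X s).den n := fun s n hn => by
    simp only [T]
    rw [(X s).discSum_succ (hθ s) hn]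
    ring
  have hT' : ∀ s, ∀ n < (X s).reflect.den,
      -T n = ratSum (X s).reflect.num (X s).reflect.den n := fun s n hn => by
    rw [(X s).ratSum_reflect hn, hT s n hn]
  refine ⟨θ, hx (hθ 0), irrational_of_mem_nhd hθ hex, T, fun n => by simp [T], ?_, ?_, ?_, ?_⟩
  · intro hc
    refine ⟨eventually_le_of_refinements hden hT fun s => (hX s).1.le_upper hc, fun ε hε => ?_⟩
    refine frequently_ge_of_rises hc_pos hden hT (Frequently.mono ?_ fun s hs => (hX s).2.1 hs) hε
    exact frequently_atTop.mpr fun N => ⟨2 * N, by omega, hc, Or.inl (even_two_mul N)⟩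
  · intro hc
    refine ⟨(X 0).up, fun n => ?_⟩
    have := le_of_rises (X := fun s => (X s).reflect) (T := fun n => -T n) hden hT'
      (fun s => (hX s).2.2 fun h => hc h.1) n
    rw [neg_neg] at this
    exact this
  · intro hd
    refine ⟨eventually_le_of_refinements (X := fun s => (X s).reflect) (T := fun n => -T n)
      hden hT' fun s => (hX s).1.reflect.le_upper hd, fun ε hε => ?_⟩
    refine frequently_ge_of_rises (X := fun s => (X s).reflect) (T := fun n => -T n) hd_pos hden
      hT' (Frequently.mono ?_ fun s hs => (hX s).2.2 hs) hε
    refine frequently_atTop.mpr fun N => ⟨2 * N + 1, by omega, ?_⟩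
    rintro ⟨-, h | h⟩
    · exact absurd h (by simp [parity_simps])
    · exact h hd
  · intro hd
    exact ⟨(X 0).low, le_of_rises hden hT fun s => (hX s).2.1 ⟨hdiv.resolve_right hd, Or.inr hd⟩⟩

/-! ### From the sums to the maximal and minimal discrepancies. -/

theorem limsup_div_eq_one {c : ℕ → ℝ} {M : ℕ → ℤ} {K : ℝ} (hc_pos : ∀ n, 0 < c n)
    (hc : Tendsto c atTop atTop) (hle : ∀ᶠ n in atTop, (M n : ℝ) ≤ c n + K)
    (hge : ∀ ε > 0, ∃ᶠ n in atTop, (1 - ε) * c n - K ≤ M n) :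
    limsup (fun n : ℕ => (((M n : ℝ) / c n : ℝ) : EReal)) atTop = 1 := by
  have hK : ∀ ε > 0, ∀ᶠ n in atTop, K / c n ≤ ε := fun ε hε => by
    filter_upwards [(hc.const_div_atTop K).eventually_lt_const hε] with n hn using hn.le
  apply le_antisymm
  · refine EReal.le_of_forall_lt_iff_le.mp fun z hz => ?_
    have hz' : 0 < z - 1 := sub_pos.mpr (by exact_mod_cast hz)
    refine limsup_le_of_le (h := ?_)
    filter_upwards [hle, hK _ hz'] with n h1 h2
    rw [EReal.coe_le_coe_iff, div_le_iff₀ (hc_pos n)]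
    rw [div_le_iff₀ (hc_pos n)] at h2
    linarith
  · refine EReal.ge_of_forall_gt_iff_ge.mp fun z hz => ?_
    have hz' : 0 < (1 - z) / 2 := half_pos (sub_pos.mpr (by exact_mod_cast hz))
    refine le_limsup_of_frequently_le ?_
    refine ((hge _ hz').and_eventually (hK _ hz')).mono fun n hn => ?_
    obtain ⟨h1, h2⟩ := hn
    rw [EReal.coe_le_coe_iff, le_div_iff₀ (hc_pos n)]
    rw [div_le_iff₀ (hc_pos n)] at h2
    linarith

theorem maxDisc_le_iff {θ : ℝ} {n : ℕ} {K : ℤ} :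
    maxDisc θ 0 n ≤ K ↔ ∀ i ∈ discTimes n, discSum θ 0 i ≤ K :=
  Finset.sup'_le_iff _ _

theorem le_minDisc_iff {θ : ℝ} {n : ℕ} {K : ℤ} :
    K ≤ minDisc θ 0 n ↔ ∀ i ∈ discTimes n, K ≤ discSum θ 0 i :=
  Finset.le_inf'_iff _ _

theorem one_le_maxDisc (θ : ℝ) (n : ℕ) : 1 ≤ maxDisc θ 0 n := by
  refine le_trans ?_ (Finset.le_sup' (discSum θ 0) (b := 1) (by simp [discTimes]))
  simp [discSum, halfSign]

theorem minDisc_le_one (θ : ℝ) (n : ℕ) : minDisc θ 0 n ≤ 1 := by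
  refine le_trans (Finset.inf'_le (discSum θ 0) (b := 1) (by simp [discTimes])) ?_
  simp [discSum, halfSign]

theorem succ_mem_discTimes (i : ℕ) : i + 1 ∈ discTimes (i + 2) := by
  simp [discTimes]

theorem exists_eq_succ_of_mem_discTimes {n i : ℕ} (hi : i ∈ discTimes n) :
    ∃ j, i = j + 1 ∧ j ≤ n := by
  simp only [discTimes, Finset.mem_Icc] at hi
  exact ⟨i - 1, by omega, by omega⟩

/-- A sequence eventually bounded by the monotone `c` has partial maxima bounded by `c`, up to a
constant. -/
theorem exists_forall_le_add {T : ℕ → ℤ} {c : ℕ → ℝ} (hc_pos : ∀ n, 0 < c n)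
    (hc_mono : Monotone c) (h : ∀ᶠ n in atTop, (T n : ℝ) ≤ c n) :
    ∃ K : ℝ, 0 ≤ K ∧ ∀ j n, j ≤ n → (T j : ℝ) ≤ c n + K := by
  obtain ⟨N, hN⟩ := eventually_atTop.mp h
  refine ⟨∑ j ∈ Finset.range N, |(T j : ℝ)|, by positivity, fun j n hjn => ?_⟩
  have h0 : 0 ≤ ∑ j ∈ Finset.range N, |(T j : ℝ)| := by positivity
  rcases le_or_gt N j with hj | hj
  · linarith [hN j hj, hc_mono hjn]
  · have := Finset.single_le_sum (f := fun j => |(T j : ℝ)|) (fun _ _ => abs_nonneg _)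
      (Finset.mem_range.mpr hj)
    linarith [le_abs_self (T j : ℝ), hc_pos n]

theorem limsup_maxDisc_div {θ : ℝ} {T : ℕ → ℤ} {c : ℕ → ℝ}
    (hT : ∀ n, discSum θ 0 (n + 1) = 1 + T n) (hc_pos : ∀ n, 0 < c n) (hc_mono : Monotone c)
    (hc : Tendsto c atTop atTop) (hle : ∀ᶠ n in atTop, (T n : ℝ) ≤ c n)
    (hge : ∀ ε > 0, ∃ᶠ n in atTop, (1 - ε) * c (n + 2) ≤ T n) :
    limsup (fun n : ℕ => (((maxDisc θ 0 n : ℝ) / c n : ℝ) : EReal)) atTop = 1 := by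
  obtain ⟨K, hK0, hK⟩ := exists_forall_le_add hc_pos hc_mono hle
  refine limsup_div_eq_one (K := K + 1) hc_pos hc (Eventually.of_forall fun n => ?_)
    fun ε hε => ?_
  · obtain ⟨i, hi, heq⟩ := Finset.exists_mem_eq_sup' (discTimes_nonempty n) (discSum θ 0)
    obtain ⟨j, rfl, hj⟩ := exists_eq_succ_of_mem_discTimes hi
    rw [maxDisc, heq, hT]
    push_cast
    linarith [hK j n hj]
  -- `T n` belongs to time `n + 1`, which first enters the maximum at index `n + 2`; hence `c (n +
  -- 2)` in the lower bound.
  · refine (tendsto_add_atTop_nat 2).frequently ((hge ε hε).mono fun n hn => ?_)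
    have : ((1 + T n : ℤ) : ℝ) ≤ maxDisc θ 0 (n + 2) := by
      rw [← hT]
      exact_mod_cast Finset.le_sup' (discSum θ 0) (succ_mem_discTimes n)
    push_cast at this
    linarith

theorem limsup_abs_minDisc_div {θ : ℝ} {T : ℕ → ℤ} {d : ℕ → ℝ}
    (hT : ∀ n, discSum θ 0 (n + 1) = 1 + T n) (hd_pos : ∀ n, 0 < d n) (hd_mono : Monotone d)
    (hd : Tendsto d atTop atTop) (hle : ∀ᶠ n in atTop, ((-T n : ℤ) : ℝ) ≤ d n)
    (hge : ∀ ε > 0, ∃ᶠ n in atTop, (1 - ε) * d (n + 2) ≤ ((-T n : ℤ) : ℝ)) :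
    limsup (fun n : ℕ => ((((|minDisc θ 0 n| : ℤ) : ℝ) / d n : ℝ) : EReal)) atTop = 1 := by
  obtain ⟨K, hK0, hK⟩ := exists_forall_le_add (T := fun n => -T n) hd_pos hd_mono hle
  refine limsup_div_eq_one (K := K + 1) hd_pos hd (Eventually.of_forall fun n => ?_)
    fun ε hε => ?_
  · obtain ⟨i, hi, heq⟩ := Finset.exists_mem_eq_inf' (discTimes_nonempty n) (discSum θ 0)
    obtain ⟨j, rfl, hj⟩ := exists_eq_succ_of_mem_discTimes hi
    have h1 : (minDisc θ 0 n : ℝ) ≤ 1 := by exact_mod_cast minDisc_le_one θ n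
    have h2 := hK j n hj
    have h3 : (minDisc θ 0 n : ℝ) = 1 + T j := by
      rw [minDisc, heq, hT]
      push_cast
      ring
    push_cast at h2 ⊢
    rw [abs_le]
    constructor <;> linarith [hd_pos n]
  · refine (tendsto_add_atTop_nat 2).frequently ((hge ε hε).mono fun n hn => ?_)
    have : (minDisc θ 0 (n + 2) : ℝ) ≤ ((1 + T n : ℤ) : ℝ) := by
      rw [← hT]
      exact_mod_cast Finset.inf'_le (discSum θ 0) (succ_mem_discTimes n)
    push_cast at this hn ⊢
    linarith [neg_abs_le (minDisc θ 0 (n + 2) : ℝ)]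

theorem theorem2 (c d : ℕ → ℝ)
    (hc_pos : ∀ n, 0 < c n) (hd_pos : ∀ n, 0 < d n)
    (hc_mono : Monotone c) (hd_mono : Monotone d)
    (hc_o : c =o[atTop] (fun n : ℕ => (n : ℝ)))
    (hd_o : d =o[atTop] (fun n : ℕ => (n : ℝ)))
    (hc_diff : (fun n : ℕ => c (n + 1) - c n) =O[atTop] (fun _ : ℕ => (1 : ℝ)))
    (hd_diff : (fun n : ℕ => d (n + 1) - d n) =O[atTop] (fun _ : ℕ => (1 : ℝ)))
    (hdiv : Tendsto c atTop atTop ∨ Tendsto d atTop atTop) :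
    ∃ Θ : Set ℝ, Θ ⊆ Set.Ioo (0 : ℝ) 1 ∧ Set.Ioo (0 : ℝ) 1 ⊆ closure Θ ∧
      ∀ θ ∈ Θ, Irrational θ ∧
        (Tendsto c atTop atTop →
          limsup (fun n : ℕ => (((maxDisc θ 0 n : ℝ) / c n : ℝ) : EReal)) atTop = 1) ∧
        (BddAbove (Set.range c) → ∃ K : ℤ, ∀ n : ℕ, |maxDisc θ 0 n| ≤ K) ∧
        (Tendsto d atTop atTop →
          limsup (fun n : ℕ => ((((|minDisc θ 0 n| : ℤ) : ℝ) / d n : ℝ) : EReal)) atTop = 1) ∧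
        (BddAbove (Set.range d) → ∃ K : ℤ, ∀ n : ℕ, |minDisc θ 0 n| ≤ K) := by
  have not_div : ∀ {c : ℕ → ℝ}, BddAbove (Set.range c) → ¬ Tendsto c atTop atTop :=
    fun hb ht => not_bddAbove_of_tendsto_atTop ht hb
  -- The set consists of all angles with the required properties, so only its density needs proof.
  refine ⟨{θ | θ ∈ Set.Ioo (0 : ℝ) 1 ∧ _}, fun θ hθ => hθ.1, fun t ht => ?_, fun θ hθ => hθ.2⟩
  rw [Metric.mem_closure_iff]
  intro δ hδ
  obtain ⟨θ, hθ, hirr, T, hT, hcT, hcK, hdT, hdK⟩ := exists_angle hc_pos hd_pos hc_mono hd_mono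
    hc_o hd_o hdiv (u := max 0 (t - δ)) (v := min 1 (t + δ))
    (max_lt (lt_min one_pos (by linarith [ht.1])) (lt_min (by linarith [ht.2]) (by linarith)))
  obtain ⟨h1, h2⟩ := max_lt_iff.mp hθ.1
  obtain ⟨h3, h4⟩ := lt_min_iff.mp hθ.2
  refine ⟨θ, ⟨⟨h1, h3⟩, hirr, fun hc => ?_, fun hb => ?_, fun hd => ?_, fun hb => ?_⟩, ?_⟩
  · exact limsup_maxDisc_div hT hc_pos hc_mono hc (hcT hc).1 (hcT hc).2
  · obtain ⟨K, hK⟩ := hcK (not_div hb)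
    refine ⟨1 + K, fun n => ?_⟩
    rw [abs_of_nonneg (zero_le_one.trans (one_le_maxDisc θ n)), maxDisc_le_iff]
    intro i hi
    obtain ⟨j, rfl, -⟩ := exists_eq_succ_of_mem_discTimes hi
    rw [hT]
    linarith [hK j]
  · exact limsup_abs_minDisc_div hT hd_pos hd_mono hd (hdT hd).1 (hdT hd).2
  · obtain ⟨K, hK⟩ := hdK (not_div hb)
    refine ⟨1 + |K|, fun n => abs_le.mpr ⟨?_, ?_⟩⟩
    · rw [le_minDisc_iff]
      intro i hi
      obtain ⟨j, rfl, -⟩ := exists_eq_succ_of_mem_discTimes hi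
      rw [hT]
      linarith [hK j, le_abs_self K]
    · linarith [minDisc_le_one θ n, abs_nonneg K]
  · rw [Real.dist_eq, abs_lt]
    constructor <;> linarith
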